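/- Let $k\ge 2$ be an integer and $n=\frac{k(k+3)}{2}$. For a real polynomial $Q(t,s)$ in two variables let $\|Q\|$ denote the $\ell^2$ norm of its coefficients. A collection of $m$ sets $S_1,\dots,S_m\subset[0,1]^2$ is called $\nu$-transverse for $\mathcal M_{2,k}=\{(t^is^j)_{1\le i+j\le k}:(t,s)\in[0,1]^2\}\subset\mathbb R^n$ if $m\ge n$ and, for any distinct indices $i_1,\dots,i_{\lfloor m/n\rfloor+1}\in\{1,\dots,m\}$, $$\inf_{\substack{\deg Q\le 2k-2\\ \|Q\|=1}}\ \max_{1\le j\le \lfloor m/n\rfloor+1}\ \inf_{(t,s)\in S_{i_j}}|Q(t,s)|\ \ge\ \nu .$$ For $K=2^l$ with $l\in\{0,1,2,\dots\}$, let $\mathrm{Col}_K$ be the collection of the $K^2$ closed dyadic squares $\left[\frac{a}{K},\frac{a+1}{K}\right]\times\left[\frac{b}{K},\frac{b+1}{K}\right]$, $0\le a,b<K$ integers. Theorem. For every integer $k\ge2$ there exists $\Lambda=\Lambda_k>0$ such that for each $K=2^l$, $l\in\{0,1,2,\dots\}$, there exists $\nu_K=\nu_{K,k}>0$ with the following property: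 for every $m\ge\Lambda K$, any $m$ distinct squares in $\mathrm{Col}_K$ are $\nu_K$-transverse for $\mathcal M_{2,k}$. -/

import Mathlib

/-- The dimension `n = k(k+3)/2` of the Euclidean space containing the surface `M_{2,k}`
(the number of monomials `t^i s^j` with `1 ≤ i + j ≤ k`). -/
def ambientDim (k : ℕ) : ℕ := k * (k + 3) / 2

/-- The `ℓ²` norm of the coefficients of a real polynomial in two variables. -/
noncomputable def coeffNorm (Q : MvPolynomial (Fin 2) ℝ) : ℝ :=
  Real.sqrt (∑ d ∈ Q.support, (Q.coeff d) ^ 2)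

/-- A collection `S_1, …, S_m` of subsets of the unit square `[0,1]²` is `ν`-transverse for
`M_{2,k}`: `m ≥ n`, and for any `⌊m/n⌋ + 1` distinct indices, the infimum over the polynomials `Q`
of degree at most `2k - 2` and coefficient norm one of the maximum, over the chosen indices, of the
infimum of `|Q|` over the corresponding set is at least `ν`. Infima and maxima are taken in the
extended reals. -/
def IsTransverse (k : ℕ) (ν : ℝ) {m : ℕ} (S : Fin m → Set (Fin 2 → ℝ)) : Prop :=
  ambientDim k ≤ m ∧
  (∀ j, S j ⊆ Set.Icc (0 : Fin 2 → ℝ) 1) ∧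
  ∀ i : Fin (m / ambientDim k + 1) → Fin m, Function.Injective i →
    (ν : EReal) ≤
      ⨅ (Q : MvPolynomial (Fin 2) ℝ) (_ : Q.totalDegree ≤ 2 * k - 2) (_ : coeffNorm Q = 1),
        ⨆ j : Fin (m / ambientDim k + 1),
          ⨅ p ∈ S (i j), ((|MvPolynomial.eval p Q| : ℝ) : EReal)

/-- The closed dyadic squares of side length `1 / 2 ^ l` contained in `[0,1]²`. -/
def dyadicSquares (l : ℕ) : Set (Set (Fin 2 → ℝ)) :=
  {R | ∃ a : Fin 2 → ℕ, (∀ c, a c < 2 ^ l) ∧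
    R = {x | ∀ c, (a c : ℝ) / 2 ^ l ≤ x c ∧ x c ≤ ((a c : ℝ) + 1) / 2 ^ l}}

/-! The core is that the zero set of a nonzero `Q` of degree `d` meets only `O(d² K)` of the `K²`
grid squares. If `Q` vanishes in a square but not on its left, right or lower edge, it has one sign
on the union of these edges. The horizontal segment through the zero then has ends of equal sign, so
`∂Q/∂x` vanishes in the square (`exists_zero_on_edge_or_pderiv`). Squares with a zero on an edge are
counted line by line (`card_edges_meeting_zeros_le`); the others are handled by induction on the
degree (`card_gridSquares_meeting_zeros_le`).

For fixed `K`, compactness of the unit sphere of coefficients upgrades this to one `ν > 0`: for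
every normalized `Q`, all but `O(d² K)` squares satisfy `|Q| ≥ ν` throughout
(`exists_pos_card_gridSquares_small_le`). Once `m / n` exceeds this count, any `⌊m/n⌋ + 1` squares
include a good one. -/

/-! ### Lines and polynomials in two variables -/

/-- A polynomial in two variables restricted to the horizontal line of height `y`. -/
noncomputable def restrictHorizontal (Q : MvPolynomial (Fin 2) ℝ) (y : ℝ) : Polynomial ℝ :=
  MvPolynomial.aeval ![Polynomial.X, Polynomial.C y] Q

/-- A polynomial in two variables restricted to the vertical line of abscissa `x`. -/
noncomputable def restrictVertical (Q : MvPolynomial (Fin 2) ℝ) (x : ℝ) : Polynomial ℝ :=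
  MvPolynomial.aeval ![Polynomial.C x, Polynomial.X] Q

theorem eval_restrictHorizontal (Q : MvPolynomial (Fin 2) ℝ) (x y : ℝ) :
    (restrictHorizontal Q y).eval x = MvPolynomial.eval ![x, y] Q := by
  unfold restrictHorizontal
  induction Q using MvPolynomial.induction_on with
  | C a => simp
  | add p q hp hq => simp [hp, hq]
  | mul_X p i hp => fin_cases i <;> simp [hp]

theorem eval_restrictVertical (Q : MvPolynomial (Fin 2) ℝ) (x y : ℝ) :
    (restrictVertical Q x).eval y = MvPolynomial.eval ![x, y] Q := by
  unfold restrictVertical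
  induction Q using MvPolynomial.induction_on with
  | C a => simp
  | add p q hp hq => simp [hp, hq]
  | mul_X p i hp => fin_cases i <;> simp [hp]

theorem natDegree_restrictHorizontal_le {Q : MvPolynomial (Fin 2) ℝ} {d : ℕ}
    (hQ : Q.totalDegree ≤ d) (y : ℝ) : (restrictHorizontal Q y).natDegree ≤ d := by
  have := MvPolynomial.aeval_natDegree_le (n := 1) Q hQ ![Polynomial.X, Polynomial.C y]
    (by intro i; fin_cases i <;> simp)
  simpa [restrictHorizontal] using this

theorem natDegree_restrictVertical_le {Q : MvPolynomial (Fin 2) ℝ} {d : ℕ}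
    (hQ : Q.totalDegree ≤ d) (x : ℝ) : (restrictVertical Q x).natDegree ≤ d := by
  have := MvPolynomial.aeval_natDegree_le (n := 1) Q hQ ![Polynomial.C x, Polynomial.X]
    (by intro i; fin_cases i <;> simp)
  simpa [restrictVertical] using this

theorem derivative_restrictHorizontal (Q : MvPolynomial (Fin 2) ℝ) (y : ℝ) :
    (restrictHorizontal Q y).derivative = restrictHorizontal (MvPolynomial.pderiv 0 Q) y := by
  unfold restrictHorizontal
  induction Q using MvPolynomial.induction_on with
  | C a => simp
  | add p q hp hq => simp [hp, hq]
  | mul_X p i hp => fin_cases i <;> simp [hp, MvPolynomial.pderiv_X] <;> ring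

theorem totalDegree_pderiv_le {σ : Type*} (Q : MvPolynomial σ ℝ) (i : σ) :
    (MvPolynomial.pderiv i Q).totalDegree ≤ Q.totalDegree - 1 := by
  classical
  conv_lhs => rw [Q.as_sum, map_sum]
  refine MvPolynomial.totalDegree_finsetSum_le fun s hs => ?_
  rw [MvPolynomial.pderiv_monomial]
  by_cases hi : s i = 0
  · simp [hi]
  refine (MvPolynomial.totalDegree_monomial_le _ _).trans ?_
  have h1 : Finsupp.single i 1 ≤ s := by
    rw [Finsupp.single_le_iff]; omega
  have h2 := MvPolynomial.le_totalDegree hs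
  have h3 : (s - Finsupp.single i 1 + Finsupp.single i 1).degree = s.degree := by
    rw [tsub_add_cancel_of_le h1]
  rw [map_add, Finsupp.degree_single] at h3
  change s.degree ≤ _ at h2
  change (s - Finsupp.single i 1).degree ≤ _
  omega

theorem exists_eval_pair_ne_zero {Q : MvPolynomial (Fin 2) ℝ} (hQ : Q ≠ 0) :
    ∃ x y : ℝ, MvPolynomial.eval ![x, y] Q ≠ 0 := by
  by_contra! h
  refine hQ (MvPolynomial.funext fun v => ?_)
  have : v = ![v 0, v 1] := by ext i; fin_cases i <;> rfl
  rw [this, h, map_zero]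

/-! ### Counting the grid intervals and grid squares met by a zero set -/

theorem card_filter_mem_interval_le (K : ℕ) (hK : 0 < K) (r : ℝ) :
    ((Finset.range K).filter
      (fun b : ℕ => (b : ℝ) / K ≤ r ∧ r ≤ ((b : ℝ) + 1) / K)).card ≤ 2 := by
  have hK' : (0 : ℝ) < K := by exact_mod_cast hK
  -- Closed neighbours share an endpoint, hence two candidates. At floor `0` truncated subtraction
  -- merely makes them coincide.
  refine (Finset.card_le_card (t := {⌊r * K⌋₊, ⌊r * K⌋₊ - 1}) fun b hb => ?_).trans
    Finset.card_le_two
  obtain ⟨-, h1, h2⟩ := Finset.mem_filter.1 hb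
  rw [div_le_iff₀ hK'] at h1
  rw [le_div_iff₀ hK'] at h2
  have h3 : b ≤ ⌊r * K⌋₊ := Nat.le_floor h1
  have h4 : ⌊r * K⌋₊ ≤ b + 1 := Nat.floor_le_of_le (by push_cast; exact h2)
  simp only [Finset.mem_insert, Finset.mem_singleton]
  omega

open Classical in
theorem card_intervals_meeting_roots_le (K : ℕ) (hK : 0 < K) {d : ℕ} {p : Polynomial ℝ}
    (hp : p ≠ 0) (hd : p.natDegree ≤ d) :
    ((Finset.range K).filter
      (fun b : ℕ => ∃ y : ℝ, (b : ℝ) / K ≤ y ∧ y ≤ ((b : ℝ) + 1) / K ∧ p.eval y = 0)).card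
      ≤ 2 * d := by
  refine (Finset.card_le_card (t := p.roots.toFinset.biUnion fun r => (Finset.range K).filter
    (fun b : ℕ => (b : ℝ) / K ≤ r ∧ r ≤ ((b : ℝ) + 1) / K)) fun b hb => ?_).trans ?_
  · obtain ⟨hb, y, h1, h2, h3⟩ := Finset.mem_filter.1 hb
    refine Finset.mem_biUnion.2 ⟨y, ?_, Finset.mem_filter.2 ⟨hb, h1, h2⟩⟩
    simpa [hp] using h3
  · refine (Finset.card_biUnion_le_card_mul _ _ 2
      fun r _ => card_filter_mem_interval_le K hK r).trans ?_
    have := (Multiset.toFinset_card_le p.roots).trans ((Polynomial.card_roots' p).trans hd)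
    omega

open Classical in
/-- A function `g` of two variables that is polynomial of degree at most `d` in each of them has
zeros on at most `3 d K` of the grid intervals that lie on `K` parallel lines. -/
theorem card_edges_meeting_zeros_le (K : ℕ) (hK : 0 < K) {d : ℕ} {g : ℝ → ℝ → ℝ}
    {p q : ℝ → Polynomial ℝ} (hp : ∀ x y, (p x).eval y = g x y) (hq : ∀ x y, (q y).eval x = g x y)
    (hpd : ∀ x, (p x).natDegree ≤ d) (hqd : ∀ y, (q y).natDegree ≤ d)
    (hg : ∃ x y, g x y ≠ 0) {u : ℕ → ℝ} (hu : Function.Injective u) :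
    ((Finset.range K ×ˢ Finset.range K).filter (fun a : ℕ × ℕ =>
      ∃ y : ℝ, (a.2 : ℝ) / K ≤ y ∧ y ≤ ((a.2 : ℝ) + 1) / K ∧ g (u a.1) y = 0)).card
      ≤ 3 * d * K := by
  obtain ⟨x₀, y₀, hxy⟩ := hg
  -- Each line inside the zero set gives a root of the single nonzero polynomial `q y₀`. At most `d`
  -- such lines lose all `K` intervals; every other line loses at most `2 * d`.
  have hbad : ((Finset.range K).filter (fun a => p (u a) = 0)).card ≤ d := by
    have hq0 : q y₀ ≠ 0 := fun h => hxy (by rw [← hq, h, Polynomial.eval_zero])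
    rw [← Finset.card_image_of_injective _ hu]
    refine (Finset.card_le_card (t := (q y₀).roots.toFinset) fun z hz => ?_).trans
      ((Multiset.toFinset_card_le _).trans ((Polynomial.card_roots' _).trans (hqd y₀)))
    obtain ⟨a, ha, rfl⟩ := Finset.mem_image.1 hz
    have ha := (Finset.mem_filter.1 ha).2
    simp [hq0, hq, ← hp, ha]
  rw [Finset.card_filter, Finset.sum_product]
  calc _ ≤ ∑ a ∈ Finset.range K, ((if p (u a) = 0 then K else 0) + 2 * d) := by
        refine Finset.sum_le_sum fun a _ => ?_
        rw [← Finset.card_filter]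
        by_cases h : p (u a) = 0
        · rw [if_pos h]
          exact ((Finset.card_filter_le _ _).trans_eq (Finset.card_range K)).trans
            (Nat.le_add_right _ _)
        · rw [if_neg h, zero_add]
          simpa only [hp] using card_intervals_meeting_roots_le K hK h (hpd _)
    _ = ((Finset.range K).filter (fun a => p (u a) = 0)).card * K + K * (2 * d) := by
        rw [Finset.sum_add_distrib, ← Finset.sum_filter, Finset.sum_const, Finset.sum_const,
          Finset.card_range, smul_eq_mul, smul_eq_mul]
    _ ≤ d * K + K * (2 * d) := by gcongr
    _ = 3 * d * K := by ring

theorem Polynomial.exists_eval_eq_zero_of_mul_nonpos (p : Polynomial ℝ) {a b : ℝ} (hab : a ≤ b)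
    (h : p.eval a * p.eval b ≤ 0) : ∃ c ∈ Set.Icc a b, p.eval c = 0 := by
  have hc : ContinuousOn (fun x => p.eval x) (Set.Icc a b) := p.continuous.continuousOn
  rcases mul_nonpos_iff.1 h with ⟨h1, h2⟩ | ⟨h1, h2⟩
  · exact intermediate_value_Icc' hab hc ⟨h2, h1⟩
  · exact intermediate_value_Icc hab hc ⟨h1, h2⟩

/-- A polynomial that has a zero in an interval and the same nonzero sign at both ends has a
critical point in that interval. -/
theorem Polynomial.exists_derivative_eval_eq_zero (p : Polynomial ℝ) {a b c : ℝ}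
    (hac : a ≤ c) (hcb : c ≤ b) (hc : p.eval c = 0) (h : 0 < p.eval a * p.eval b) :
    ∃ x ∈ Set.Icc a b, p.derivative.eval x = 0 := by
  wlog ha : 0 < p.eval a generalizing p
  · have ha' : p.eval a ≠ 0 := fun h0 => by simp [h0] at h
    obtain ⟨x, hx, hx'⟩ := this (-p) (by simpa using hc) (by simpa using h)
      (by simpa using lt_of_le_of_ne (not_lt.1 ha) ha')
    exact ⟨x, hx, by simpa using hx'⟩
  have hb : 0 < p.eval b := (mul_pos_iff_of_pos_left ha).1 h
  -- The minimum is at most `p.eval c = 0` while both end values are positive, so it is attained in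
  -- the interior.
  obtain ⟨x, hx, hmin⟩ := isCompact_Icc.exists_isMinOn (Set.nonempty_Icc.2 (hac.trans hcb))
    (p.continuous.continuousOn (s := Set.Icc a b))
  have hx0 : p.eval x ≤ 0 := hc ▸ hmin (show c ∈ Set.Icc a b from ⟨hac, hcb⟩)
  have hxa : x ≠ a := by rintro rfl; linarith
  have hxb : x ≠ b := by rintro rfl; linarith
  refine ⟨x, hx, ?_⟩
  have hloc : IsLocalMin (fun x => p.eval x) x :=
    hmin.isLocalMin (Icc_mem_nhds (lt_of_le_of_ne hx.1 hxa.symm) (lt_of_le_of_ne hx.2 hxb))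
  exact hloc.hasDerivAt_eq_zero (p.hasDerivAt x)

/-- The closed grid square of side `1 / K` with lower left corner `(a.1 / K, a.2 / K)`. -/
def gridSquare (K : ℕ) (a : ℕ × ℕ) : Set (ℝ × ℝ) :=
  Set.Icc ((a.1 : ℝ) / K) (((a.1 : ℝ) + 1) / K) ×ˢ Set.Icc ((a.2 : ℝ) / K) (((a.2 : ℝ) + 1) / K)

theorem mem_gridSquare {K : ℕ} {a : ℕ × ℕ} {x y : ℝ} :
    (x, y) ∈ gridSquare K a ↔ ((a.1 : ℝ) / K ≤ x ∧ x ≤ ((a.1 : ℝ) + 1) / K) ∧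
      ((a.2 : ℝ) / K ≤ y ∧ y ≤ ((a.2 : ℝ) + 1) / K) := Iff.rfl

/-- If `Q` vanishes on a grid square, then it vanishes on its left, right or lower edge, or
`∂Q/∂x` vanishes on the square. -/
theorem exists_zero_on_edge_or_pderiv {K : ℕ} {a : ℕ × ℕ} {Q : MvPolynomial (Fin 2) ℝ}
    {x y : ℝ} (hxy : (x, y) ∈ gridSquare K a) (hQ : MvPolynomial.eval ![x, y] Q = 0) :
    (∃ t : ℝ, (a.2 : ℝ) / K ≤ t ∧ t ≤ ((a.2 : ℝ) + 1) / K ∧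
      MvPolynomial.eval ![(a.1 : ℝ) / K, t] Q = 0) ∨
    (∃ t : ℝ, (a.2 : ℝ) / K ≤ t ∧ t ≤ ((a.2 : ℝ) + 1) / K ∧
      MvPolynomial.eval ![((a.1 : ℝ) + 1) / K, t] Q = 0) ∨
    (∃ t : ℝ, (a.1 : ℝ) / K ≤ t ∧ t ≤ ((a.1 : ℝ) + 1) / K ∧
      MvPolynomial.eval ![t, (a.2 : ℝ) / K] Q = 0) ∨
    ∃ z w : ℝ, (z, w) ∈ gridSquare K a ∧
      MvPolynomial.eval ![z, w] (MvPolynomial.pderiv 0 Q) = 0 := by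
  obtain ⟨⟨hx1, hx2⟩, hy1, hy2⟩ := mem_gridSquare.1 hxy
  set x₀ := (a.1 : ℝ) / K
  set x₁ := ((a.1 : ℝ) + 1) / K
  set y₀ := (a.2 : ℝ) / K
  by_contra! hcon
  obtain ⟨hl, hr, hb, hd⟩ := hcon
  have same_left : 0 < MvPolynomial.eval ![x₀, y₀] Q * MvPolynomial.eval ![x₀, y] Q := by
    by_contra! h
    simp only [← eval_restrictVertical] at h
    obtain ⟨c, hc, hc'⟩ := Polynomial.exists_eval_eq_zero_of_mul_nonpos _ hy1 h
    exact hl c hc.1 (hc.2.trans hy2) (eval_restrictVertical Q x₀ c ▸ hc')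
  have same_right : 0 < MvPolynomial.eval ![x₁, y₀] Q * MvPolynomial.eval ![x₁, y] Q := by
    by_contra! h
    simp only [← eval_restrictVertical] at h
    obtain ⟨c, hc, hc'⟩ := Polynomial.exists_eval_eq_zero_of_mul_nonpos _ hy1 h
    exact hr c hc.1 (hc.2.trans hy2) (eval_restrictVertical Q x₁ c ▸ hc')
  have same_bottom : 0 < MvPolynomial.eval ![x₀, y₀] Q * MvPolynomial.eval ![x₁, y₀] Q := by
    by_contra! h
    simp only [← eval_restrictHorizontal] at h
    obtain ⟨c, hc, hc'⟩ :=
      Polynomial.exists_eval_eq_zero_of_mul_nonpos _ (hx1.trans hx2) h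
    exact hb c hc.1 hc.2 (eval_restrictHorizontal Q c y₀ ▸ hc')
  -- The sign is carried from `(x₀, y)` down the left edge, along the bottom and up the right edge
  -- to `(x₁, y)`.
  have same : 0 < MvPolynomial.eval ![x₀, y] Q * MvPolynomial.eval ![x₁, y] Q := by
    have h := mul_pos same_left same_right
    rw [mul_mul_mul_comm] at h
    exact (mul_pos_iff_of_pos_left same_bottom).1 h
  obtain ⟨z, hz, hz'⟩ := (restrictHorizontal Q y).exists_derivative_eval_eq_zero hx1 hx2
    (by rw [eval_restrictHorizontal, hQ]) (by simpa only [eval_restrictHorizontal] using same)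
  rw [derivative_restrictHorizontal, eval_restrictHorizontal] at hz'
  exact hd z y (mem_gridSquare.2 ⟨hz, hy1, hy2⟩) hz'

open Classical in
/-- The zero set of a nonzero polynomial of degree at most `d` meets at most `9 d² K` squares of the
`K × K` grid. -/
theorem card_gridSquares_meeting_zeros_le (K : ℕ) (hK : 0 < K) (d : ℕ) :
    ∀ Q : MvPolynomial (Fin 2) ℝ, Q ≠ 0 → Q.totalDegree ≤ d →
      ((Finset.range K ×ˢ Finset.range K).filter (fun a : ℕ × ℕ =>
        ∃ x y : ℝ, (x, y) ∈ gridSquare K a ∧ MvPolynomial.eval ![x, y] Q = 0)).card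
        ≤ 9 * d ^ 2 * K := by
  have hK' : (0 : ℝ) < K := by exact_mod_cast hK
  have inj₀ : Function.Injective (fun a : ℕ => (a : ℝ) / K) := fun a b h => by
    simpa [div_left_inj' hK'.ne'] using h
  have inj₁ : Function.Injective (fun a : ℕ => ((a : ℝ) + 1) / K) := fun a b h => by
    simpa [div_left_inj' hK'.ne'] using h
  induction d with
  | zero =>
    intro Q hQ hd
    rw [Finset.filter_false_of_mem]
    · simp
    rintro a - ⟨x, y, -, h⟩
    have hC := MvPolynomial.totalDegree_eq_zero_iff_eq_C.1 (Nat.le_zero.1 hd)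
    rw [hC, MvPolynomial.eval_C] at h
    exact hQ (by rw [hC, h, MvPolynomial.C_0])
  | succ d ih =>
    intro Q hQ hd
    set G := Finset.range K ×ˢ Finset.range K with hG
    have hne := exists_eval_pair_ne_zero hQ
    set L := G.filter (fun a : ℕ × ℕ => ∃ t : ℝ, (a.2 : ℝ) / K ≤ t ∧
      t ≤ ((a.2 : ℝ) + 1) / K ∧ MvPolynomial.eval ![(a.1 : ℝ) / K, t] Q = 0) with hL
    set R := G.filter (fun a : ℕ × ℕ => ∃ t : ℝ, (a.2 : ℝ) / K ≤ t ∧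
      t ≤ ((a.2 : ℝ) + 1) / K ∧ MvPolynomial.eval ![((a.1 : ℝ) + 1) / K, t] Q = 0) with hR
    set B := G.filter (fun a : ℕ × ℕ => ∃ t : ℝ, (a.1 : ℝ) / K ≤ t ∧
      t ≤ ((a.1 : ℝ) + 1) / K ∧ MvPolynomial.eval ![t, (a.2 : ℝ) / K] Q = 0) with hB
    have cL : L.card ≤ 3 * (d + 1) * K :=
      card_edges_meeting_zeros_le K hK (g := fun x y => MvPolynomial.eval ![x, y] Q)
        (u := fun a : ℕ => (a : ℝ) / K)
        (p := restrictVertical Q) (q := restrictHorizontal Q)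
        (fun x y => eval_restrictVertical Q x y) (fun x y => eval_restrictHorizontal Q x y)
        (natDegree_restrictVertical_le hd) (natDegree_restrictHorizontal_le hd) hne inj₀
    have cR : R.card ≤ 3 * (d + 1) * K :=
      card_edges_meeting_zeros_le K hK (g := fun x y => MvPolynomial.eval ![x, y] Q)
        (u := fun a : ℕ => ((a : ℝ) + 1) / K)
        (p := restrictVertical Q) (q := restrictHorizontal Q)
        (fun x y => eval_restrictVertical Q x y) (fun x y => eval_restrictHorizontal Q x y)
        (natDegree_restrictVertical_le hd) (natDegree_restrictHorizontal_le hd) hne inj₁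
    have cB : B.card ≤ 3 * (d + 1) * K := by
      refine le_trans (le_of_eq ?_) (card_edges_meeting_zeros_le K hK
        (g := fun y x => MvPolynomial.eval ![x, y] Q) (u := fun a : ℕ => (a : ℝ) / K)
        (p := restrictHorizontal Q) (q := restrictVertical Q)
        (fun y x => eval_restrictHorizontal Q x y) (fun y x => eval_restrictVertical Q x y)
        (natDegree_restrictHorizontal_le hd) (natDegree_restrictVertical_le hd)
        (hne.elim fun x ⟨y, h⟩ => ⟨y, x, h⟩) inj₀)
      refine Finset.card_equiv (Equiv.prodComm ℕ ℕ) fun a => ?_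
      simp [hB, hG, and_comm]
    -- The induction hypothesis needs a nonzero derivative. If it is zero, `Q` is constant on
    -- horizontal lines and any zero slides to the left edge.
    by_cases h0 : MvPolynomial.pderiv 0 Q = 0
    · refine (Finset.card_le_card (t := L) fun a ha => ?_).trans (cL.trans ?_)
      · obtain ⟨haG, x, y, hxy, hz⟩ := Finset.mem_filter.1 ha
        obtain ⟨hx, hy1, hy2⟩ := mem_gridSquare.1 hxy
        refine Finset.mem_filter.2 ⟨haG, y, hy1, hy2, ?_⟩
        have hder : (restrictHorizontal Q y).derivative = 0 := by
          rw [derivative_restrictHorizontal, h0, restrictHorizontal, map_zero]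
        rw [← eval_restrictHorizontal] at hz ⊢
        rw [Polynomial.eq_C_of_derivative_eq_zero hder] at hz ⊢
        simpa using hz
      · gcongr ?_ * K
        nlinarith
    · have cD := ih _ h0 ((totalDegree_pderiv_le Q 0).trans (by omega))
      refine (Finset.card_le_card (t := L ∪ (R ∪ (B ∪ G.filter (fun a : ℕ × ℕ => ∃ x y : ℝ,
        (x, y) ∈ gridSquare K a ∧ MvPolynomial.eval ![x, y] (MvPolynomial.pderiv 0 Q) = 0))))
        fun a ha => ?_).trans ?_
      · obtain ⟨haG, x, y, hxy, hz⟩ := Finset.mem_filter.1 ha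
        simp only [Finset.mem_union, hL, hR, hB, Finset.mem_filter, haG, true_and]
        exact exists_zero_on_edge_or_pderiv hxy hz
      · refine (Finset.card_union_le _ _).trans ((add_le_add_right ((Finset.card_union_le _ _).trans
          (add_le_add_right (Finset.card_union_le _ _) _)) _).trans ?_)
        -- Three edge counts and the induction hypothesis: `9(d+1) + 9d² ≤ 9(d+1)²`, with slack
        -- `9d`.
        nlinarith [Nat.zero_le (d * K)]

/-! ### Compactness of the unit sphere of coefficients -/

/-- The polynomial in two variables with given coefficients of the monomials of degree at most `d`
in each variable. -/
noncomputable def polynomialOfCoeffs (d : ℕ) (c : Fin (d + 1) × Fin (d + 1) → ℝ) :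
    MvPolynomial (Fin 2) ℝ :=
  ∑ s, MvPolynomial.monomial (Finsupp.equivFunOnFinite.symm ![(s.1 : ℕ), (s.2 : ℕ)]) (c s)

theorem coeff_polynomialOfCoeffs (d : ℕ) (c : Fin (d + 1) × Fin (d + 1) → ℝ)
    (s : Fin (d + 1) × Fin (d + 1)) :
    (polynomialOfCoeffs d c).coeff (Finsupp.equivFunOnFinite.symm ![(s.1 : ℕ), (s.2 : ℕ)])
      = c s := by
  classical
  rw [polynomialOfCoeffs, MvPolynomial.coeff_sum, Finset.sum_eq_single s]
  · simp
  · intro t _ hts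
    rw [MvPolynomial.coeff_monomial, if_neg]
    intro h
    have h' := Finsupp.equivFunOnFinite.symm.injective h
    exact hts (Prod.ext (Fin.ext (by simpa using congrFun h' 0))
      (Fin.ext (by simpa using congrFun h' 1)))
  · simp

theorem eval_polynomialOfCoeffs (d : ℕ) (c : Fin (d + 1) × Fin (d + 1) → ℝ) (x y : ℝ) :
    MvPolynomial.eval ![x, y] (polynomialOfCoeffs d c)
      = ∑ s, c s * (x ^ (s.1 : ℕ) * y ^ (s.2 : ℕ)) := by
  simp [polynomialOfCoeffs, MvPolynomial.eval_monomial, Finsupp.prod_fintype]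

/-- The exponents fill a box rather than a triangle, so `x^d y^d` occurs; this is the source of `2 *
d` in the later bounds. -/
theorem totalDegree_polynomialOfCoeffs_le (d : ℕ) (c : Fin (d + 1) × Fin (d + 1) → ℝ) :
    (polynomialOfCoeffs d c).totalDegree ≤ 2 * d := by
  refine MvPolynomial.totalDegree_finsetSum_le fun s _ => ?_
  refine (MvPolynomial.totalDegree_monomial_le _ _).trans ?_
  rw [Finsupp.sum_fintype _ _ (by simp)]
  simp
  omega

/-- Every polynomial of degree at most `d` and coefficient norm one comes from a point of the unit
sphere of the coefficient space. -/
theorem exists_polynomialOfCoeffs_eq {d : ℕ} {Q : MvPolynomial (Fin 2) ℝ}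
    (hd : Q.totalDegree ≤ d) (hQ : coeffNorm Q = 1) :
    ∃ c, ∑ s, c s ^ 2 = 1 ∧ polynomialOfCoeffs d c = Q := by
  classical
  set e : Fin (d + 1) × Fin (d + 1) → Fin 2 →₀ ℕ :=
    fun s => Finsupp.equivFunOnFinite.symm ![(s.1 : ℕ), (s.2 : ℕ)] with he
  have hinj : Function.Injective e := fun s t h => by
    have h' := Finsupp.equivFunOnFinite.symm.injective h
    exact Prod.ext (Fin.ext (by simpa using congrFun h' 0))
      (Fin.ext (by simpa using congrFun h' 1))
  have hsub : Q.support ⊆ Finset.univ.image e := fun m hm => by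
    have hm' : ∀ i, m i ≤ d := fun i => by
      have h1 := MvPolynomial.le_totalDegree hm
      rw [Finsupp.sum_fintype _ _ (by simp)] at h1
      exact (Finset.single_le_sum (f := fun i => m i) (fun _ _ => Nat.zero_le _)
        (Finset.mem_univ i)).trans (h1.trans hd)
    refine Finset.mem_image.2 ⟨(⟨m 0, Nat.lt_succ_of_le (hm' 0)⟩, ⟨m 1, Nat.lt_succ_of_le (hm' 1)⟩),
      Finset.mem_univ _, ?_⟩
    ext i
    fin_cases i <;> rfl
  refine ⟨fun s => Q.coeff (e s), ?_, ?_⟩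
  · rw [coeffNorm, Real.sqrt_eq_one] at hQ
    rw [← hQ, Finset.sum_subset hsub (by simp +contextual),
      Finset.sum_image fun _ _ _ _ h => hinj h]
  · conv_rhs => rw [Q.as_sum, Finset.sum_subset hsub (by simp +contextual),
      Finset.sum_image fun _ _ _ _ h => hinj h]
    rfl

theorem isCompact_gridSquare (K : ℕ) (a : ℕ × ℕ) : IsCompact (gridSquare K a) :=
  isCompact_Icc.prod isCompact_Icc

theorem isCompact_unit_sphere_sum_sq (ι : Type*) [Fintype ι] :
    IsCompact {c : ι → ℝ | ∑ s, c s ^ 2 = 1} := by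
  refine (isCompact_univ_pi fun _ : ι => isCompact_Icc (a := (-1 : ℝ)) (b := 1)).of_isClosed_subset
    (isClosed_eq (by fun_prop) continuous_const) fun c hc s _ => ?_
  have : c s ^ 2 ≤ 1 := by
    rw [← show ∑ s, c s ^ 2 = 1 from hc]
    exact Finset.single_le_sum (f := fun s => c s ^ 2) (fun _ _ => sq_nonneg _) (Finset.mem_univ s)
  exact abs_le.1 (sq_le_one_iff_abs_le_one _ |>.1 this)

/-- Continuous functions that are nonzero on a compact set stay uniformly away from zero there under
small perturbations. -/
theorem IsCompact.exists_pos_eventually_le_abs {X Y : Type*} [TopologicalSpace X]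
    [TopologicalSpace Y] {F : X → Y → ℝ} (hF : Continuous (Function.uncurry F)) {S : Set Y}
    (hS : IsCompact S) {c₀ : X} (h : ∀ p ∈ S, F c₀ p ≠ 0) :
    ∃ ν : ℝ, 0 < ν ∧ ∀ᶠ c in nhds c₀, ∀ p ∈ S, ν ≤ |F c p| := by
  rcases S.eq_empty_or_nonempty with rfl | hne
  · exact ⟨1, one_pos, by simp⟩
  have hF' : Continuous (fun z : X × Y => |F z.1 z.2|) := hF.abs
  obtain ⟨p₀, hp₀, hmin⟩ := hS.exists_isMinOn hne
    (f := fun p => |F c₀ p|) (hF'.comp (Continuous.prodMk_right c₀)).continuousOn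
  have hpos : 0 < |F c₀ p₀| := abs_pos.2 (h p₀ hp₀)
  refine ⟨|F c₀ p₀| / 2, half_pos hpos,
    hS.eventually_forall_of_forall_eventually fun p hp => ?_⟩
  have hlt : |F c₀ p₀| / 2 < |F c₀ p| := (half_lt_self hpos).trans_le (hmin hp)
  exact (hF'.continuousAt.eventually (lt_mem_nhds hlt)).mono fun _ h => le_of_lt h

open Classical in
/-- A quantitative form of `card_gridSquares_meeting_zeros_le`, uniform over the polynomials of
degree at most `d` and coefficient norm one. -/
theorem exists_pos_card_gridSquares_small_le (K : ℕ) (hK : 0 < K) (d : ℕ) :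
    ∃ ν : ℝ, 0 < ν ∧ ∀ Q : MvPolynomial (Fin 2) ℝ, Q.totalDegree ≤ d → coeffNorm Q = 1 →
      ((Finset.range K ×ˢ Finset.range K).filter (fun a : ℕ × ℕ =>
        ¬ ∀ p ∈ gridSquare K a, ν ≤ |MvPolynomial.eval ![p.1, p.2] Q|)).card
        ≤ 9 * (2 * d) ^ 2 * K := by
  set G := Finset.range K ×ˢ Finset.range K
  set F : (Fin (d + 1) × Fin (d + 1) → ℝ) → ℝ × ℝ → ℝ :=
    fun c p => MvPolynomial.eval ![p.1, p.2] (polynomialOfCoeffs d c) with hFdef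
  have hF : Continuous (Function.uncurry F) := by
    simp only [hFdef, eval_polynomialOfCoeffs, Function.uncurry_def]
    fun_prop
  suffices H : ∃ ν : ℝ, 0 < ν ∧
      ∀ c ∈ {c : Fin (d + 1) × Fin (d + 1) → ℝ | ∑ s, c s ^ 2 = 1},
        (G.filter (fun a => ¬ ∀ p ∈ gridSquare K a, ν ≤ |F c p|)).card ≤ 9 * (2 * d) ^ 2 * K by
    obtain ⟨ν, hν, H⟩ := H
    refine ⟨ν, hν, fun Q hd hQ => ?_⟩
    obtain ⟨c, hc, rfl⟩ := exists_polynomialOfCoeffs_eq hd hQ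
    exact H c hc
  have mono : ∀ {c} {ν ν' : ℝ}, ν ≤ ν' →
      (G.filter (fun a => ¬ ∀ p ∈ gridSquare K a, ν' ≤ |F c p|)).card ≤ 9 * (2 * d) ^ 2 * K →
      (G.filter (fun a => ¬ ∀ p ∈ gridSquare K a, ν ≤ |F c p|)).card ≤ 9 * (2 * d) ^ 2 * K :=
    fun hle h => (Finset.card_le_card (Finset.monotone_filter_right _
      fun a _ ha ha' => ha fun p hp => hle.trans (ha' p hp))).trans h
  -- Having a common `ν` passes to subsets and, by taking minima, to unions, so it only has to be
  -- found near each `c₀`.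
  refine (isCompact_unit_sphere_sum_sq _).induction_on
    (p := fun S => ∃ ν : ℝ, 0 < ν ∧ ∀ c ∈ S,
      (G.filter (fun a => ¬ ∀ p ∈ gridSquare K a, ν ≤ |F c p|)).card ≤ 9 * (2 * d) ^ 2 * K)
    ⟨1, one_pos, by simp⟩ ?_ ?_ ?_
  · rintro S T hST ⟨ν, hν, h⟩
    exact ⟨ν, hν, fun c hc => h c (hST hc)⟩
  · rintro S T ⟨ν, hν, h⟩ ⟨ν', hν', h'⟩
    refine ⟨min ν ν', lt_min hν hν', ?_⟩
    rintro c (hc | hc)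
    · exact mono (min_le_left _ _) (h c hc)
    · exact mono (min_le_right _ _) (h' c hc)
  · intro c₀ hc₀
    have hQ0 : polynomialOfCoeffs d c₀ ≠ 0 := fun h0 => by
      have : c₀ = 0 := funext fun s => by rw [← coeff_polynomialOfCoeffs d c₀ s, h0]; simp
      simp [this] at hc₀
    have hcard := card_gridSquares_meeting_zeros_le K hK (2 * d) _ hQ0
      (totalDegree_polynomialOfCoeffs_le d c₀)
    -- Squares meeting the zero set of `c₀` get the dummy value `1`, so that a minimum over all of
    -- `G` can be taken.
    have hloc : ∀ a : ℕ × ℕ, ∃ ν : ℝ, 0 < ν ∧ ((∀ p ∈ gridSquare K a, F c₀ p ≠ 0) →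
        ∀ᶠ c in nhds c₀, ∀ p ∈ gridSquare K a, ν ≤ |F c p|) := fun a => by
      by_cases h : ∀ p ∈ gridSquare K a, F c₀ p ≠ 0
      · obtain ⟨ν, hν, h'⟩ := (isCompact_gridSquare K a).exists_pos_eventually_le_abs hF h
        exact ⟨ν, hν, fun _ => h'⟩
      · exact ⟨1, one_pos, fun h' => absurd h' h⟩
    choose ν hν hloc using hloc
    have hGne : G.Nonempty := ⟨(0, 0), by simp [G, hK]⟩
    refine ⟨_, mem_nhdsWithin_of_mem_nhds ((Filter.eventually_all_finset G).2 fun a _ =>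
      Filter.eventually_imp_distrib_left.2 (hloc a)), G.inf' hGne ν,
      (Finset.lt_inf'_iff hGne).2 fun a _ => hν a, fun c hc => ?_⟩
    -- For `c` near `c₀`, a square can be bad only if it meets the zero set of `c₀`.
    refine (Finset.card_le_card fun a ha => ?_).trans hcard
    obtain ⟨haG, ha⟩ := Finset.mem_filter.1 ha
    refine Finset.mem_filter.2 ⟨haG, ?_⟩
    by_contra! hcon
    exact ha fun p hp => (Finset.inf'_le ν haG).trans
      (hc a haG (fun q hq => hcon q.1 q.2 hq) p hp)

/-! ### Transversality by pigeonhole -/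

theorem mainTheorem12 (k : ℕ) (hk : 2 ≤ k) :
    ∃ Λ : ℝ, 0 < Λ ∧ ∀ l : ℕ, ∃ ν : ℝ, 0 < ν ∧
      ∀ (m : ℕ) (R : Fin m → Set (Fin 2 → ℝ)),
        Function.Injective R →
        (∀ j, R j ∈ dyadicSquares l) →
        Λ * (2 : ℝ) ^ l ≤ (m : ℝ) →
        IsTransverse k ν R := by
  classical
  set n := ambientDim k with hn
  have hnpos : 0 < n := by
    rw [hn, ambientDim]
    exact Nat.div_pos (by nlinarith) two_pos
  set C := 9 * (2 * (2 * k - 2)) ^ 2 with hC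
  -- At most `C * K` squares are bad in degree `2k - 2`; `Λ = n (C + 1)` forces `m / n + 1 > C * K`,
  -- despite the floor.
  refine ⟨((n * (C + 1) : ℕ) : ℝ), by positivity, fun l => ?_⟩
  have hK : 0 < 2 ^ l := by positivity
  have hK' : (0 : ℝ) < 2 ^ l := by positivity
  obtain ⟨ν, hν, hsmall⟩ := exists_pos_card_gridSquares_small_le (2 ^ l) hK (2 * k - 2)
  refine ⟨ν, hν, fun m R hR hdy hm => ?_⟩
  have hm' : n * (C + 1) * 2 ^ l ≤ m := by exact_mod_cast hm
  have hmn : C * 2 ^ l < m / n + 1 := by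
    have : (C + 1) * 2 ^ l ≤ m / n := by
      rw [Nat.le_div_iff_mul_le hnpos]
      linarith
    nlinarith
  refine ⟨?_, fun j => ?_, fun i hi => ?_⟩
  · have : n * 1 ≤ n * ((C + 1) * 2 ^ l) :=
      Nat.mul_le_mul_left _ (Nat.one_le_iff_ne_zero.2 (by positivity))
    linarith
  · obtain ⟨a, ha, hRa⟩ := hdy j
    rw [hRa]
    refine fun x hx => ⟨fun c => (show (0 : ℝ) ≤ (a c : ℝ) / 2 ^ l by positivity).trans (hx c).1,
      fun c => (hx c).2.trans ?_⟩
    rw [Pi.one_apply, div_le_one hK']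
    exact_mod_cast ha c
  choose a ha hRa using hdy
  refine le_iInf fun Q => le_iInf fun hd => le_iInf fun hQ => ?_
  set b : Fin (m / n + 1) → ℕ × ℕ := fun j => (a (i j) 0, a (i j) 1) with hb
  have hbinj : Function.Injective b := fun j j' h => by
    refine hi (hR ?_)
    have : a (i j) = a (i j') := by
      ext c
      fin_cases c
      · exact congrArg Prod.fst h
      · exact congrArg Prod.snd h
    rw [hRa, hRa, this]
  have hlarge : ∃ j, ∀ p ∈ gridSquare (2 ^ l) (b j), ν ≤ |MvPolynomial.eval ![p.1, p.2] Q| := by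
    by_contra! hcon
    have hle := Finset.card_le_card_of_injOn (s := Finset.univ) b (fun j _ => by
      refine Finset.mem_coe.2 (Finset.mem_filter.2 ⟨?_, fun h => ?_⟩)
      · exact Finset.mem_product.2 ⟨Finset.mem_range.2 (ha _ _), Finset.mem_range.2 (ha _ _)⟩
      · obtain ⟨p, hp, hlt⟩ := hcon j
        exact absurd (h p hp) (not_le.2 hlt)) hbinj.injOn |>.trans (hsmall Q hd hQ)
    rw [Finset.card_univ, Fintype.card_fin] at hle
    exact absurd hle (not_le.2 hmn)
  obtain ⟨j, hj⟩ := hlarge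
  refine le_iSup_of_le j (le_iInf fun p => le_iInf fun hp => ?_)
  rw [EReal.coe_le_coe_iff]
  rw [hRa] at hp
  have hpair : p = ![p 0, p 1] := by ext c; fin_cases c <;> rfl
  have := hj (p 0, p 1) (mem_gridSquare.2 (by push_cast; exact ⟨hp 0, hp 1⟩))
  rwa [← hpair] at this
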